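/- Let $\boldsymbol{k}=\mathbb{R}$ or $\mathbb{C}$, let $n,k\ge 0$ and $m\ge 1$ be integers, and let $S=\boldsymbol{k}[x_1,\dots,x_n]$. A Nambu-Poisson bracket of arity $m$ on a commutative $\boldsymbol{k}$-algebra $A$ is a $\boldsymbol{k}$-multilinear antisymmetric map $\{\,,\dots,\,\}:A^m\to A$ such that for all $a_1,\dots,a_{m-1},b_1,\dots,b_m,a,b\in A$ $$\{a_1,\dots,a_{m-1},ab\}=a\{a_1,\dots,a_{m-1},b\}+b\{a_1,\dots,a_{m-1},a\},$$ $$\{a_1,\dots,a_{m-1},\{b_1,\dots,b_m\}\}=\sum_{l=1}^m\{b_1,\dots,b_{l-1},\{a_1,\dots,a_{m-1},b_l\},b_{l+1},\dots,b_m\}.$$ Let $X^1,\dots,X^{k+m}$ be pairwise commuting $\boldsymbol{k}$-linear derivations of $S$, and let $g,f_1,\dots,f_k\in S$. For $a_1,\dots,a_m\in S$ put $f_{k+i}:=a_i$ $(1\le i\le m)$ and $$\{a_1,\dots,a_m\}:=g\,\operatorname{Det}\bigl(X^\nu(f_\mu)\bigr)_{\mu,\nu=1,\dots,k+m}.$$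 Then: 1. $\{\,,\dots,\,\}$ is a Nambu-Poisson bracket of arity $m$ on $S$. 2. $f_1,\dots,f_k$ are Casimirs: $\{a_1,\dots,a_{m-1},f_\mu\}=0$ for all $a_1,\dots,a_{m-1}\in S$ and $1\le\mu\le k$. 3. The ideal $I=(f_1,\dots,f_k)$ is a Nambu-Poisson ideal, i.e. $\{I,S,\dots,S\}\subseteq I$, and there is a unique Nambu-Poisson bracket of arity $m$ on $S/I$ with $\{s_1+I,\dots,s_m+I\}=\{s_1,\dots,s_m\}+I$ for all $s_1,\dots,s_m\in S$. Thus $S/I$ is a Nambu-Poisson algebra. -/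

import Mathlib

/-- A Nambu-Poisson bracket of arity `m = p + 1` (so `m ≥ 1`) on a commutative `𝕜`-algebra `A`:
a `𝕜`-multilinear antisymmetric map satisfying the Leibniz rule in the last argument and the
fundamental (Filippov) identity. Here `Fin.snoc a x` is the tuple `(a₁, …, a_{m-1}, x)`. -/
structure IsNambuPoissonBracket (𝕜 : Type*) {A : Type*} [CommRing 𝕜] [CommRing A] [Algebra 𝕜 A]
    {p : ℕ} (B : (Fin (p + 1) → A) → A) : Prop where
  map_update_add : ∀ (a : Fin (p + 1) → A) (i : Fin (p + 1)) (x y : A),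
    B (Function.update a i (x + y)) = B (Function.update a i x) + B (Function.update a i y)
  map_update_smul : ∀ (a : Fin (p + 1) → A) (i : Fin (p + 1)) (c : 𝕜) (x : A),
    B (Function.update a i (c • x)) = c • B (Function.update a i x)
  antisymm : ∀ (a : Fin (p + 1) → A) (σ : Equiv.Perm (Fin (p + 1))),
    B (fun i => a (σ i)) = (Equiv.Perm.sign σ : ℤ) • B a
  leibniz : ∀ (a : Fin p → A) (x y : A),
    B (Fin.snoc (α := fun _ => A) a (x * y)) =
      x * B (Fin.snoc (α := fun _ => A) a y) + y * B (Fin.snoc (α := fun _ => A) a x)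
  fundamental : ∀ (a : Fin p → A) (b : Fin (p + 1) → A),
    B (Fin.snoc (α := fun _ => A) a (B b)) =
      ∑ l, B (Function.update b l (B (Fin.snoc (α := fun _ => A) a (b l))))

/-- `f` is a Casimir of the bracket `B`: `{a₁, …, a_{m-1}, f} = 0` for all `a₁, …, a_{m-1}`. -/
def IsCasimir {A : Type*} [CommRing A] {p : ℕ} (B : (Fin (p + 1) → A) → A) (f : A) : Prop :=
  ∀ a : Fin p → A, B (Fin.snoc (α := fun _ => A) a f) = 0

/-- `I` is a Nambu-Poisson ideal for the bracket `B`: `{I, A, …, A} ⊆ I`. -/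
def IsNambuPoissonIdeal {A : Type*} [CommRing A] {p : ℕ} (B : (Fin (p + 1) → A) → A)
    (I : Ideal A) : Prop :=
  ∀ a : Fin (p + 1) → A, a 0 ∈ I → B a ∈ I

/-- The determinantal bracket `{a₁, …, aₘ} = g · Det (X^ν (f_μ))_{μ,ν = 1, …, k + m}`, where
`f_{k+i} = aᵢ` for `i = 1, …, m`. -/
def detBracket {𝕜 A : Type*} [CommRing 𝕜] [CommRing A] [Algebra 𝕜 A] {k m : ℕ}
    (X : Fin (k + m) → Derivation 𝕜 A A) (g : A) (f : Fin k → A) (a : Fin m → A) : A :=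
  g * (Matrix.of fun μ ν : Fin (k + m) => X ν (Fin.append f a μ)).det

/-!
Write `J(b) = Det (X^ν (b_μ))`. Expanding along the row of `b_i`, the map `x ↦ g J(b with b_i := x)`
is the derivation `∑ v_ν X^ν`, where `v_ν` is `g` times a cofactor. Since the `X^ν` commute, a
derivation `V = ∑ v_ν X^ν` satisfies `∑_μ J(b with b_μ := V b_μ) = V (J(b)) + (div v) J(b)` with
`div v = ∑ X^ν (v_ν)`, and the cofactors of a row of the Jacobian matrix have divergence zero
because second derivatives are symmetric. Hence `g div v = V g`, which is precisely what makes
`V (g J(b))` expand as the fundamental identity requires. If moreover `f_1, …, f_k` are among the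
functions defining `V`, then `V f_μ = 0`, and the identity restricts to the remaining arguments.

By the Leibniz rule an ideal generated by Casimirs is a Nambu-Poisson ideal, and a bracket descends
to the quotient by any such ideal.
-/

open Function Matrix

section Determinant

theorem sum_sum_mul_eq_zero_of_alternating_of_isSymm {ι R : Type*} [Fintype ι]
    [NonUnitalNonAssocRing R] {S T : Matrix ι ι R} (hdiag : ∀ i, S i i = 0)
    (hneg : ∀ i j, S i j = -S j i) (hT : T.IsSymm) : ∑ i, ∑ j, S i j * T i j = 0 := by
  rw [← Finset.sum_product' Finset.univ Finset.univ fun i j => S i j * T i j]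
  refine Finset.sum_involution (fun q _ => q.swap) ?_ ?_ (by simp) (by simp)
  · rintro ⟨i, j⟩ -
    rw [Prod.swap_prod_mk, hneg i j, hT.apply j i, neg_mul, neg_add_cancel]
  · rintro ⟨i, j⟩ - hne heq
    obtain rfl : j = i := congrArg Prod.fst heq
    exact hne (by rw [hdiag, zero_mul])

theorem derivation_prod {R A M ι : Type*} [CommSemiring R] [CommSemiring A] [AddCommMonoid M]
    [Algebra R A] [Module A M] [Module R M] [DecidableEq ι] (D : Derivation R A M)
    (s : Finset ι) (f : ι → A) :
    D (∏ i ∈ s, f i) = ∑ i ∈ s, (∏ j ∈ s.erase i, f j) • D (f i) := by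
  induction s using Finset.induction_on with
  | empty => simp
  | insert a s ha ih =>
    have herase : ∀ i ∈ s, ∏ j ∈ (insert a s).erase i, f j = f a * ∏ j ∈ s.erase i, f j :=
      fun i hi => by
        rw [Finset.erase_insert_of_ne (ne_of_mem_of_not_mem hi ha).symm,
          Finset.prod_insert fun h => ha (Finset.mem_of_mem_erase h)]
    rw [Finset.prod_insert ha, D.leibniz, ih, Finset.sum_insert ha, Finset.erase_insert ha,
      add_comm, Finset.smul_sum]
    congr 1
    exact Finset.sum_congr rfl fun i hi => by rw [herase i hi, mul_smul]

variable {𝕜 A ι : Type*} [CommRing 𝕜] [CommRing A] [Algebra 𝕜 A] [Fintype ι] [DecidableEq ι]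

theorem derivation_det (D : Derivation 𝕜 A A) (M : Matrix ι ι A) :
    D M.det = ∑ i, (M.updateRow i fun j => D (M i j)).det := by
  have hprod : ∀ (σ : Equiv.Perm ι) (i : ι),
      ∏ j, M.updateRow i (fun l => D (M i l)) j (σ j) =
        (∏ j ∈ Finset.univ.erase i, M j (σ j)) * D (M i (σ i)) := fun σ i => by
    rw [← Finset.prod_erase_mul _ _ (Finset.mem_univ i), updateRow_self]
    congr 1
    exact Finset.prod_congr rfl fun j hj => by rw [updateRow_ne (Finset.ne_of_mem_erase hj)]
  simp only [← det_transpose M, ← det_transpose (updateRow _ _ _), det_apply', transpose_apply,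
    map_sum, D.leibniz, D.map_intCast, smul_eq_mul, mul_zero, add_zero, derivation_prod, hprod,
    Finset.mul_sum]
  exact Finset.sum_comm

theorem det_updateRow_eq_sum_adjugate (M : Matrix ι ι A) (i : ι) (r : ι → A) :
    (M.updateRow i r).det = ∑ j, M.adjugate j i * r j := by
  rw [← cramer_transpose_apply, cramer_eq_adjugate_mulVec, ← adjugate_transpose]
  rfl

theorem sum_det_updateRow_mul (M K : Matrix ι ι A) :
    ∑ i, (M.updateRow i ((M * K) i)).det = K.trace * M.det := calc
  _ = (M * K * M.adjugate).trace := by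
    simp only [det_updateRow_eq_sum_adjugate, trace, Matrix.diag_apply, mul_apply (M := M * K),
      mul_comm]
  _ = K.trace * M.det := by
    rw [trace_mul_comm, ← Matrix.mul_assoc, adjugate_mul, smul_mul, Matrix.one_mul, trace_smul,
      smul_eq_mul, mul_comm]

theorem det_updateRow_updateRow_swap (M : Matrix ι ι A) {i j : ι} (h : i ≠ j) (r s : ι → A) :
    ((M.updateRow i r).updateRow j s).det = -((M.updateRow i s).updateRow j r).det := by
  have hrows : (M.updateRow i r).updateRow j s =
      ((M.updateRow i s).updateRow j r).submatrix (Equiv.swap i j) id := by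
    ext l c
    simp only [submatrix_apply, updateRow_apply, Equiv.swap_apply_def, id]
    grind
  rw [hrows, det_permute, Equiv.Perm.sign_swap h]
  simp

theorem det_updateRow_updateRow_self (M : Matrix ι ι A) {i j : ι} (h : i ≠ j) (r : ι → A) :
    ((M.updateRow i r).updateRow j r).det = 0 :=
  det_zero_of_row_eq h (by rw [updateRow_ne h, updateRow_self, updateRow_self])

end Determinant

section Jacobian

variable {𝕜 A ι : Type*} [CommRing 𝕜] [CommRing A] [Algebra 𝕜 A]

theorem derivation_apply_comm {D₁ D₂ : Derivation 𝕜 A A} (h : ⁅D₁, D₂⁆ = 0) (x : A) :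
    D₁ (D₂ x) = D₂ (D₁ x) := by
  rw [← sub_eq_zero, ← Derivation.commutator_apply, h, Derivation.zero_apply]

/-- The Jacobian matrix `X^ν (b_μ)` of functions `b` along derivations `X`, with row index `μ`. -/
def jacobianMatrix (X : ι → Derivation 𝕜 A A) (b : ι → A) : Matrix ι ι A :=
  of fun μ ν => X ν (b μ)

@[simp]
theorem jacobianMatrix_apply (X : ι → Derivation 𝕜 A A) (b : ι → A) (μ ν : ι) :
    jacobianMatrix X b μ ν = X ν (b μ) := rfl

theorem jacobianMatrix_update [DecidableEq ι] (X : ι → Derivation 𝕜 A A) (b : ι → A) (i : ι)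
    (x : A) :
    jacobianMatrix X (update b i x) = (jacobianMatrix X b).updateRow i fun ν => X ν x := by
  ext μ ν
  rcases eq_or_ne μ i with rfl | h
  · simp
  · simp [h]

variable [Fintype ι]

/-- The derivation `∑ v_ν X^ν`, i.e. the vector field with components `v` in the frame `X`. -/
def frameDerivation (X : ι → Derivation 𝕜 A A) (v : ι → A) : Derivation 𝕜 A A :=
  ∑ ν, v ν • X ν

theorem frameDerivation_apply (X : ι → Derivation 𝕜 A A) (v : ι → A) (x : A) :
    frameDerivation X v x = ∑ ν, v ν * X ν x := by
  rw [frameDerivation, ← Derivation.coeFnAddMonoidHom_apply, map_sum, Finset.sum_apply]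
  rfl

variable [DecidableEq ι]

/-- The derivation `x ↦ g · Det (X^ν (b_μ))` where `x` is put in place of `b_i`, given by its
components, the cofactors of row `i`; see `jacobianDerivation_apply`. -/
def jacobianDerivation (X : ι → Derivation 𝕜 A A) (g : A) (b : ι → A) (i : ι) :
    Derivation 𝕜 A A :=
  frameDerivation X fun ν => g * (jacobianMatrix X b).adjugate ν i

theorem jacobianDerivation_apply (X : ι → Derivation 𝕜 A A) (g : A) (b : ι → A) (i : ι) (x : A) :
    jacobianDerivation X g b i x = g * (jacobianMatrix X (update b i x)).det := by
  simp only [jacobianDerivation, frameDerivation_apply, jacobianMatrix_update,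
    det_updateRow_eq_sum_adjugate, Finset.mul_sum, mul_assoc]

theorem jacobianDerivation_apply_eq_zero (X : ι → Derivation 𝕜 A A) (g : A) (b : ι → A) {i j : ι}
    (h : j ≠ i) : jacobianDerivation X g b i (b j) = 0 := by
  rw [jacobianDerivation_apply, det_zero_of_row_eq h, mul_zero]
  ext ν
  simp [h]

variable {X : ι → Derivation 𝕜 A A}

theorem divergence_adjugate_jacobianMatrix (hX : ∀ i j, ⁅X i, X j⁆ = 0) (b : ι → A) (i : ι) :
    ∑ ν, X ν ((jacobianMatrix X b).adjugate ν i) = 0 := by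
  set M := jacobianMatrix X b
  simp only [adjugate_apply, derivation_det]
  rw [Finset.sum_comm]
  refine Finset.sum_eq_zero fun μ _ => ?_
  rcases eq_or_ne i μ with rfl | h
  · refine Finset.sum_eq_zero fun ν _ => det_eq_zero_of_row_eq_zero i fun j => ?_
    rcases eq_or_ne j ν with rfl | hj
    · simp
    · simp [hj]
  · let S : Matrix ι ι A := of fun ν l =>
      ((M.updateRow i (Pi.single ν 1)).updateRow μ (Pi.single l 1)).det
    let T : Matrix ι ι A := of fun ν l => X ν (X l (b μ))
    have hT : T.IsSymm := IsSymm.ext fun ν l => derivation_apply_comm (hX l ν) (b μ)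
    calc
      _ = ∑ ν, ∑ l, S ν l * T ν l := by
        simp only [updateRow_ne h.symm, det_updateRow_eq_sum_adjugate _ μ]
        simp only [adjugate_apply]
        rfl
      _ = 0 := sum_sum_mul_eq_zero_of_alternating_of_isSymm
        (fun _ => det_updateRow_updateRow_self M h _)
        (fun _ _ => det_updateRow_updateRow_swap M h _ _) hT

/-- Up to sign, the left side minus `V (Det …)` is the Lie derivative of `X^1 ∧ ⋯ ∧ X^n` along
`V = ∑ v_ν X^ν`. -/
theorem sum_det_jacobianMatrix_update_frameDerivation (hX : ∀ i j, ⁅X i, X j⁆ = 0)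
    (v b : ι → A) :
    ∑ μ, (jacobianMatrix X (update b μ (frameDerivation X v (b μ)))).det =
      frameDerivation X v (jacobianMatrix X b).det +
        (∑ ν, X ν (v ν)) * (jacobianMatrix X b).det := by
  let K : Matrix ι ι A := of fun l ν => X ν (v l)
  have hcomm : ∀ ν l x, X ν (X l x) = X l (X ν x) := fun ν l => derivation_apply_comm (hX ν l)
  have hrow : ∀ μ, (fun ν => X ν (frameDerivation X v (b μ))) =
      (fun ν => frameDerivation X v (jacobianMatrix X b μ ν)) + (jacobianMatrix X b * K) μ := by
    intro μ
    ext ν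
    simp only [Pi.add_apply, mul_apply, jacobianMatrix_apply, K, of_apply, frameDerivation_apply,
      map_sum, Derivation.leibniz, smul_eq_mul, Finset.sum_add_distrib, hcomm ν]
  simp only [jacobianMatrix_update, hrow, det_updateRow_add, Finset.sum_add_distrib,
    sum_det_updateRow_mul, derivation_det (frameDerivation X v)]
  rfl

theorem jacobianDerivation_mul_det (hX : ∀ i j, ⁅X i, X j⁆ = 0) (g : A) (h : ι → A) (i : ι)
    (b : ι → A) :
    jacobianDerivation X g h i (g * (jacobianMatrix X b).det) =
      ∑ μ, g * (jacobianMatrix X (update b μ (jacobianDerivation X g h i (b μ)))).det := by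
  set c : ι → A := fun ν => (jacobianMatrix X h).adjugate ν i
  have hdiv : g * ∑ ν, X ν (g * c ν) = jacobianDerivation X g h i g := by
    have hfree : ∑ ν, X ν (c ν) = 0 := divergence_adjugate_jacobianMatrix hX h i
    simp only [Derivation.leibniz, smul_eq_mul, Finset.sum_add_distrib, ← Finset.mul_sum, hfree,
      mul_zero, zero_add, jacobianDerivation, frameDerivation_apply, mul_assoc, c]
  rw [← Finset.mul_sum, jacobianDerivation, sum_det_jacobianMatrix_update_frameDerivation hX,
    ← jacobianDerivation, mul_add, ← mul_assoc, hdiv, Derivation.leibniz, smul_eq_mul, smul_eq_mul,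
    mul_comm (jacobianMatrix X b).det]

end Jacobian

section DetBracket

theorem fin_castAdd_ne_natAdd {k m : ℕ} (i : Fin k) (j : Fin m) :
    Fin.castAdd m i ≠ Fin.natAdd k j :=
  Fin.ne_of_lt (Nat.lt_add_right _ i.isLt)

theorem fin_append_update_right {α : Type*} {k m : ℕ} (f : Fin k → α) (a : Fin m → α) (i : Fin m)
    (x : α) : Fin.append f (update a i x) = update (Fin.append f a) (Fin.natAdd k i) x := by
  ext j
  refine Fin.addCases (fun j => ?_) (fun j => ?_) j
  · rw [Fin.append_left, update_of_ne (fin_castAdd_ne_natAdd j i), Fin.append_left]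
  · simp [update_apply]

variable {𝕜 A : Type*} [CommRing 𝕜] [CommRing A] [Algebra 𝕜 A] {k m p : ℕ}

theorem detBracket_eq (X : Fin (k + m) → Derivation 𝕜 A A) (g : A) (f : Fin k → A)
    (a : Fin m → A) : detBracket X g f a = g * (jacobianMatrix X (Fin.append f a)).det := rfl

theorem detBracket_update (X : Fin (k + m) → Derivation 𝕜 A A) (g : A) (f : Fin k → A)
    (a : Fin m → A) (i : Fin m) (x : A) :
    detBracket X g f (update a i x) =
      jacobianDerivation X g (Fin.append f a) (Fin.natAdd k i) x := by
  rw [detBracket_eq, fin_append_update_right, jacobianDerivation_apply]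

theorem detBracket_snoc (X : Fin (k + (p + 1)) → Derivation 𝕜 A A) (g : A) (f : Fin k → A)
    (a : Fin p → A) (x : A) :
    detBracket X g f (Fin.snoc (α := fun _ => A) a x) =
      jacobianDerivation X g (Fin.append f (Fin.snoc (α := fun _ => A) a 0))
        (Fin.natAdd k (Fin.last p)) x := by
  rw [← detBracket_update, Fin.update_snoc_last]

theorem jacobianDerivation_append_left (X : Fin (k + m) → Derivation 𝕜 A A) (g : A)
    (f : Fin k → A) (a : Fin m → A) (i : Fin m) (μ : Fin k) :
    jacobianDerivation X g (Fin.append f a) (Fin.natAdd k i) (f μ) = 0 := by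
  simpa only [Fin.append_left] using
    jacobianDerivation_apply_eq_zero X g (Fin.append f a) (fin_castAdd_ne_natAdd μ i)

theorem detBracket_comp_perm (X : Fin (k + m) → Derivation 𝕜 A A) (g : A) (f : Fin k → A)
    (a : Fin m → A) (σ : Equiv.Perm (Fin m)) :
    detBracket X g f (fun i => a (σ i)) = (Equiv.Perm.sign σ : ℤ) • detBracket X g f a := by
  let τ : Equiv.Perm (Fin (k + m)) := finSumFinEquiv.permCongr (Equiv.Perm.sumCongr 1 σ)
  have hsign : Equiv.Perm.sign τ = Equiv.Perm.sign σ := by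
    rw [Equiv.Perm.sign_permCongr, Equiv.Perm.sign_sumCongr, Equiv.Perm.sign_one, one_mul]
  have hrows : jacobianMatrix X (Fin.append f fun i => a (σ i)) =
      (jacobianMatrix X (Fin.append f a)).submatrix τ id := by
    ext μ ν
    refine Fin.addCases (fun j => ?_) (fun j => ?_) μ <;> simp [τ, Equiv.permCongr_apply]
  rw [detBracket_eq, hrows, det_permute, hsign, detBracket_eq, zsmul_eq_mul, mul_left_comm]

theorem detBracket_fundamental {X : Fin (k + (p + 1)) → Derivation 𝕜 A A}
    (hX : ∀ i j, ⁅X i, X j⁆ = 0) (g : A) (f : Fin k → A) (a : Fin p → A) (b : Fin (p + 1) → A) :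
    detBracket X g f (Fin.snoc (α := fun _ => A) a (detBracket X g f b)) =
      ∑ l, detBracket X g f
        (update b l (detBracket X g f (Fin.snoc (α := fun _ => A) a (b l)))) := by
  simp only [detBracket_snoc]
  have hzero : ∀ μ, g * (jacobianMatrix X (update (Fin.append f b) μ 0)).det = 0 := fun μ => by
    rw [← jacobianDerivation_apply, map_zero]
  rw [detBracket_eq, jacobianDerivation_mul_det hX, Fin.sum_univ_add]
  simp only [Fin.append_left, Fin.append_right, jacobianDerivation_append_left, hzero,
    Finset.sum_const_zero, zero_add, ← fin_append_update_right, ← detBracket_eq]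

theorem isNambuPoissonBracket_detBracket {X : Fin (k + (p + 1)) → Derivation 𝕜 A A}
    (hX : ∀ i j, ⁅X i, X j⁆ = 0) (g : A) (f : Fin k → A) :
    IsNambuPoissonBracket 𝕜 (detBracket X g f) where
  map_update_add a i x y := by simp only [detBracket_update, map_add]
  map_update_smul a i c x := by simp only [detBracket_update, Derivation.map_smul]
  antisymm := detBracket_comp_perm X g f
  leibniz a x y := by simp only [detBracket_snoc, Derivation.leibniz, smul_eq_mul]
  fundamental := detBracket_fundamental hX g f

theorem isCasimir_detBracket (X : Fin (k + (p + 1)) → Derivation 𝕜 A A) (g : A) (f : Fin k → A)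
    (μ : Fin k) : IsCasimir (detBracket X g f) (f μ) := fun a => by
  rw [detBracket_snoc, jacobianDerivation_append_left]

end DetBracket

section Ideal

variable {𝕜 A : Type*} [CommRing 𝕜] [CommRing A] [Algebra 𝕜 A] {p : ℕ}
  {B : (Fin (p + 1) → A) → A} {I : Ideal A}

namespace IsNambuPoissonBracket

theorem apply_comp_perm_mem_iff (hB : IsNambuPoissonBracket 𝕜 B) (a : Fin (p + 1) → A)
    (σ : Equiv.Perm (Fin (p + 1))) : B (fun i => a (σ i)) ∈ I ↔ B a ∈ I := by
  rw [hB.antisymm]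
  rcases Int.units_eq_one_or (Equiv.Perm.sign σ) with h | h <;> simp [h]

theorem apply_mem_of_mem (hB : IsNambuPoissonBracket 𝕜 B) (hI : IsNambuPoissonIdeal B I)
    {a : Fin (p + 1) → A} {i : Fin (p + 1)} (h : a i ∈ I) : B a ∈ I :=
  (hB.apply_comp_perm_mem_iff a (Equiv.swap 0 i)).mp <|
    hI _ (by rwa [Equiv.swap_apply_left])

/-- The derivation `{a₁, …, a_{m-1}, ·}` attached to the Hamiltonians `a`. -/
def hamiltonianDerivation (hB : IsNambuPoissonBracket 𝕜 B) (a : Fin p → A) : Derivation 𝕜 A A :=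
  Derivation.mk'
    { toFun := fun x => B (Fin.snoc (α := fun _ => A) a x)
      map_add' := fun x y => by
        simpa only [Fin.update_snoc_last] using
          hB.map_update_add (Fin.snoc (α := fun _ => A) a 0) (Fin.last p) x y
      map_smul' := fun c x => by
        simpa only [Fin.update_snoc_last, RingHom.id_apply] using
          hB.map_update_smul (Fin.snoc (α := fun _ => A) a 0) (Fin.last p) c x }
    (hB.leibniz a)

theorem isNambuPoissonIdeal_span (hB : IsNambuPoissonBracket 𝕜 B) {s : Set A}
    (hs : ∀ f ∈ s, IsCasimir B f) : IsNambuPoissonIdeal B (Ideal.span s) := by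
  have hlast : ∀ (a : Fin p → A), ∀ x ∈ Ideal.span s,
      hB.hamiltonianDerivation a x ∈ Ideal.span s := fun a x hx => by
    induction hx using Submodule.span_induction with
    | mem f hf =>
      have hzero : hB.hamiltonianDerivation a f = 0 := hs f hf a
      rw [hzero]; exact zero_mem _
    | zero => rw [map_zero]; exact zero_mem _
    | add x y _ _ hx hy => rw [map_add]; exact add_mem hx hy
    | smul r x hx ih =>
      rw [smul_eq_mul, Derivation.leibniz]
      exact add_mem (Ideal.mul_mem_left _ _ ih) (Ideal.mul_mem_right _ _ hx)
  intro a ha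
  rw [← hB.apply_comp_perm_mem_iff a (Equiv.swap 0 (Fin.last p)), ← Fin.snoc_init_self fun i => _]
  exact hlast _ _ (by rwa [Equiv.swap_apply_right])

theorem of_surjective (hB : IsNambuPoissonBracket 𝕜 B) {A' : Type*} [CommRing A'] [Algebra 𝕜 A']
    {π : A →ₐ[𝕜] A'} (hπ : Surjective π) {C : (Fin (p + 1) → A') → A'}
    (hC : ∀ a, C (π ∘ a) = π (B a)) : IsNambuPoissonBracket 𝕜 C := by
  have hupdate : ∀ (a : Fin (p + 1) → A) (i : Fin (p + 1)) (x : A),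
      C (update (π ∘ a) i (π x)) = π (B (update a i x)) := fun a i x => by
    rw [← comp_update, hC]
  have hsnoc : ∀ (a : Fin p → A) (x : A),
      C (Fin.snoc (α := fun _ => A') (π ∘ a) (π x)) = π (B (Fin.snoc (α := fun _ => A) a x)) :=
    fun a x => by rw [← Fin.comp_snoc, hC]
  constructor
  · intro a i x y
    obtain ⟨a, rfl⟩ := hπ.comp_left a
    obtain ⟨x, rfl⟩ := hπ x
    obtain ⟨y, rfl⟩ := hπ y
    rw [← map_add, hupdate, hupdate, hupdate, hB.map_update_add, map_add]
  · intro a i c x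
    obtain ⟨a, rfl⟩ := hπ.comp_left a
    obtain ⟨x, rfl⟩ := hπ x
    rw [← map_smul, hupdate, hupdate, hB.map_update_smul, map_smul]
  · intro a σ
    obtain ⟨a, rfl⟩ := hπ.comp_left a
    rw [hC, ← map_zsmul, ← hB.antisymm]
    exact hC fun i => a (σ i)
  · intro a x y
    obtain ⟨a, rfl⟩ := hπ.comp_left a
    obtain ⟨x, rfl⟩ := hπ x
    obtain ⟨y, rfl⟩ := hπ y
    rw [← map_mul, hsnoc, hsnoc, hsnoc, hB.leibniz, map_add, map_mul, map_mul]
  · intro a b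
    obtain ⟨a, rfl⟩ := hπ.comp_left a
    obtain ⟨b, rfl⟩ := hπ.comp_left b
    simp only [hC, hsnoc, Function.comp_apply, hupdate]
    rw [hB.fundamental, map_sum]

theorem apply_update_sub_apply_mem (hB : IsNambuPoissonBracket 𝕜 B)
    (hI : IsNambuPoissonIdeal B I) (a : Fin (p + 1) → A) (i : Fin (p + 1)) {x : A}
    (h : x - a i ∈ I) : B (update a i x) - B a ∈ I := by
  have hadd := hB.map_update_add a i (x - a i) (a i)
  rw [sub_add_cancel, update_eq_self] at hadd
  rw [hadd, add_sub_cancel_right]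
  exact hB.apply_mem_of_mem hI (i := i) (by rwa [update_self])

theorem mk_apply_eq_mk_apply (hB : IsNambuPoissonBracket 𝕜 B) (hI : IsNambuPoissonIdeal B I)
    {a b : Fin (p + 1) → A} (h : ∀ i, Ideal.Quotient.mk I (a i) = Ideal.Quotient.mk I (b i)) :
    Ideal.Quotient.mk I (B a) = Ideal.Quotient.mk I (B b) := by
  have hpiecewise : ∀ s : Finset (Fin (p + 1)),
      Ideal.Quotient.mk I (B (s.piecewise a b)) = Ideal.Quotient.mk I (B b) := by
    intro s
    induction s using Finset.induction_on with
    | empty => rw [Finset.piecewise_empty]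
    | insert i s hi ih =>
      rw [Finset.piecewise_insert, ← ih, Ideal.Quotient.eq]
      refine hB.apply_update_sub_apply_mem hI _ i ?_
      rw [Finset.piecewise_eq_of_notMem _ _ _ hi, ← Ideal.Quotient.eq]
      exact h i
  simpa only [Finset.piecewise_univ] using hpiecewise Finset.univ

theorem existsUnique_quotient (hB : IsNambuPoissonBracket 𝕜 B) (hI : IsNambuPoissonIdeal B I) :
    ∃! C : (Fin (p + 1) → A ⧸ I) → A ⧸ I, IsNambuPoissonBracket 𝕜 C ∧
      ∀ a : Fin (p + 1) → A,
        C (fun i => Ideal.Quotient.mk I (a i)) = Ideal.Quotient.mk I (B a) := by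
  have hmk : Surjective (Ideal.Quotient.mk I) := Ideal.Quotient.mk_surjective
  let C : (Fin (p + 1) → A ⧸ I) → A ⧸ I :=
    fun q => Ideal.Quotient.mk I (B fun i => surjInv hmk (q i))
  have hC : ∀ a : Fin (p + 1) → A,
      C (fun i => Ideal.Quotient.mk I (a i)) = Ideal.Quotient.mk I (B a) := fun _ =>
    hB.mk_apply_eq_mk_apply hI fun _ => surjInv_eq hmk _
  refine ⟨C, ⟨hB.of_surjective (Ideal.Quotient.mkₐ_surjective 𝕜 I) hC, hC⟩, ?_⟩
  rintro C' ⟨-, hC'⟩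
  funext q
  obtain ⟨a, rfl⟩ := hmk.comp_left q
  exact (hC' a).trans (hC a).symm

end IsNambuPoissonBracket

end Ideal

theorem theorem2p4_general {𝕜 A : Type*} [CommRing 𝕜] [CommRing A] [Algebra 𝕜 A] {k p : ℕ}
    {X : Fin (k + (p + 1)) → Derivation 𝕜 A A} (hX : ∀ i j, ⁅X i, X j⁆ = 0) (g : A)
    (f : Fin k → A) :
    IsNambuPoissonBracket 𝕜 (detBracket X g f) ∧
    (∀ μ : Fin k, IsCasimir (detBracket X g f) (f μ)) ∧
    IsNambuPoissonIdeal (detBracket X g f) (Ideal.span (Set.range f)) ∧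
    ∃! B : (Fin (p + 1) → A ⧸ Ideal.span (Set.range f)) → A ⧸ Ideal.span (Set.range f),
      IsNambuPoissonBracket 𝕜 B ∧
      ∀ a : Fin (p + 1) → A,
        B (fun i => Ideal.Quotient.mk (Ideal.span (Set.range f)) (a i)) =
          Ideal.Quotient.mk (Ideal.span (Set.range f)) (detBracket X g f a) := by
  have hB : IsNambuPoissonBracket 𝕜 (detBracket X g f) := isNambuPoissonBracket_detBracket hX g f
  have hf : ∀ μ, IsCasimir (detBracket X g f) (f μ) := isCasimir_detBracket X g f
  have hI : IsNambuPoissonIdeal (detBracket X g f) (Ideal.span (Set.range f)) :=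
    hB.isNambuPoissonIdeal_span (Set.forall_mem_range.mpr hf)
  exact ⟨hB, hf, hI, hB.existsUnique_quotient hI⟩

theorem theorem2p4 {𝕜 : Type*} [RCLike 𝕜] (n k p : ℕ)
    (X : Fin (k + (p + 1)) → Derivation 𝕜 (MvPolynomial (Fin n) 𝕜) (MvPolynomial (Fin n) 𝕜))
    (hX : ∀ i j, ⁅X i, X j⁆ = 0)
    (g : MvPolynomial (Fin n) 𝕜) (f : Fin k → MvPolynomial (Fin n) 𝕜) :
    IsNambuPoissonBracket 𝕜 (detBracket X g f) ∧
    (∀ μ : Fin k, IsCasimir (detBracket X g f) (f μ)) ∧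
    IsNambuPoissonIdeal (detBracket X g f) (Ideal.span (Set.range f)) ∧
    ∃! B : (Fin (p + 1) → MvPolynomial (Fin n) 𝕜 ⧸ Ideal.span (Set.range f)) →
        MvPolynomial (Fin n) 𝕜 ⧸ Ideal.span (Set.range f),
      IsNambuPoissonBracket 𝕜 B ∧
      ∀ a : Fin (p + 1) → MvPolynomial (Fin n) 𝕜,
        B (fun i => Ideal.Quotient.mk (Ideal.span (Set.range f)) (a i)) =
          Ideal.Quotient.mk (Ideal.span (Set.range f)) (detBracket X g f a) :=
  theorem2p4_general hX g f
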